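/- Say that a group is virtually $\mathcal P$ if it has a subgroup of finite index with property $\mathcal P$, and that a group $P$ is polycyclic if it has a finite series $1 = P_0 \trianglelefteq P_1 \trianglelefteq \cdots \trianglelefteq P_n = P$ in which every factor $P_{i+1}/P_i$ is cyclic. Let $G$ be a virtually soluble group, and let $A, B \le G$ be finitely generated virtually abelian subgroups of $G$. If there are only finitely many double cosets $AgB = \{agb : a \in A,\ b \in B\}$ with $g \in G$, then $G$ is virtually polycyclic. -/

import Mathlib

/-- A group is virtually soluble if it has a soluble subgroup of finite index. -/
def IsVirtuallySoluble (G : Type*) [Group G] : Prop :=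
  ∃ H : Subgroup G, H.FiniteIndex ∧ Group.IsSolvable H

/-- A group is virtually abelian if it has an abelian subgroup of finite index. -/
def IsVirtuallyAbelian (G : Type*) [Group G] : Prop :=
  ∃ H : Subgroup G, H.FiniteIndex ∧ IsMulCommutative H

/-- A group is polycyclic if it has a finite subnormal series
`1 = H 0 ⊴ H 1 ⊴ ⋯ ⊴ H n = G` all of whose factors `H (i + 1) / H i` are cyclic.
(The values `H i` for `i > n` play no role.) -/
def IsPolycyclic (G : Type*) [Group G] : Prop :=
  ∃ (n : ℕ) (H : ℕ → Subgroup G), H 0 = ⊥ ∧ H n = ⊤ ∧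
    ∀ i < n, H i ≤ H (i + 1) ∧
      ∃ _ : ((H i).subgroupOf (H (i + 1))).Normal,
        IsCyclic (H (i + 1) ⧸ (H i).subgroupOf (H (i + 1)))

/-- A group is virtually polycyclic if it has a polycyclic subgroup of finite index. -/
def IsVirtuallyPolycyclic (G : Type*) [Group G] : Prop :=
  ∃ H : Subgroup G, H.FiniteIndex ∧ IsPolycyclic H

/-!
By induction on the derived length it suffices that an abelian normal subgroup `M` of
`G = ⋃ A t B` (finitely many `t`, with `A` and `B` finitely generated abelian) is finitely
generated. The pairs `(a, b)` with `a M = b M` form a finitely generated abelian group `C`, which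
acts on `M` with finitely many orbits by `x ↦ a x b⁻¹`; written additively, this is the affine map
`x ↦ φ c • x + δ c` of the `ℤ[C]`-module `M`, which is therefore finitely generated.

By noetherian induction one reduces to the case where the image of `ℤ[C]` in the endomorphisms of
`M` is a domain `R` and `M` is torsion free over it. If all `φ c = 1`, then `R` is a quotient of
`ℤ`. Otherwise fix `c` with `φ c ≠ 1`. Since `C` is commutative, the map `x ↦ (φ c - 1) • x + δ c`
turns the affine action into the linear one, so its image meets only finitely many linear orbits.
Let `I` be a maximal ideal of `R` not containing `φ c - 1`. If `I ≠ 0`, that image contains nonzero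
elements of `I ^ n M` for every `n`, against Krull's intersection theorem; if `I = 0`, then `R` is
a field finitely generated as a ring, hence finite.
-/

/-- The maps `x ↦ φ c • x + δ c` form an action of `C` on `N` by affine maps (`δ` is a crossed
homomorphism), and this action has finitely many orbits. -/
structure HasFinitelyManyAffineOrbits {C R N : Type*} [Monoid C] [Semiring R] [AddCommMonoid N]
    [Module R N] (φ : C →* R) (δ : C → N) : Prop where
  cocycle_mul : ∀ c d, δ (c * d) = φ c • δ d + δ c
  exists_finite : ∃ S : Set N, S.Finite ∧ ∀ x, ∃ s ∈ S, ∃ c, x = φ c • s + δ c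

namespace HasFinitelyManyAffineOrbits

section Monoid

variable {C R N : Type*} [Monoid C] [Semiring R] [AddCommMonoid N] [Module R N] {φ : C →* R}
  {δ : C → N}

theorem map {N' : Type*} [AddCommMonoid N'] [Module R N'] (h : HasFinitelyManyAffineOrbits φ δ)
    {f : N →ₗ[R] N'} (hf : Function.Surjective f) : HasFinitelyManyAffineOrbits φ (f ∘ δ) := by
  obtain ⟨S, hS, hx⟩ := h.exists_finite
  refine ⟨fun c d => by simp [h.cocycle_mul], f '' S, hS.image f, fun y => ?_⟩
  obtain ⟨x, rfl⟩ := hf y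
  obtain ⟨s, hs, c, rfl⟩ := hx x
  exact ⟨f s, Set.mem_image_of_mem f hs, c, by simp⟩

theorem of_smul_eq {R' : Type*} [Semiring R'] [Module R' N] {φ' : C →* R'}
    (h : HasFinitelyManyAffineOrbits φ δ) (hφ : ∀ c (x : N), φ c • x = φ' c • x) :
    HasFinitelyManyAffineOrbits φ' δ := by
  obtain ⟨hδ, hS⟩ := h
  simp only [hφ] at hδ hS
  exact ⟨hδ, hS⟩

end Monoid

section Group

variable {C R N : Type*} [Group C] [Ring R] [AddCommGroup N] [Module R N] {φ : C →* R}
  {δ : C → N}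

theorem cocycle_one (h : HasFinitelyManyAffineOrbits φ δ) : δ 1 = 0 := by
  simpa using h.cocycle_mul 1 1

theorem cocycle_mem_of_closure_eq_top (h : HasFinitelyManyAffineOrbits φ δ) {X : Set C}
    (hX : Subgroup.closure X = ⊤) {W : Submodule R N} (hW : ∀ x ∈ X, δ x ∈ W) (c : C) :
    δ c ∈ W := by
  have hc : c ∈ Subgroup.closure X := hX ▸ Subgroup.mem_top c
  induction hc using Subgroup.closure_induction with
  | mem x hx => exact hW x hx
  | one => exact h.cocycle_one ▸ W.zero_mem
  | mul x y _ _ hx hy => exact h.cocycle_mul x y ▸ W.add_mem (W.smul_mem _ hy) hx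
  | inv x _ hx =>
    have hinv : φ x⁻¹ • δ x + δ x⁻¹ = 0 := by rw [← h.cocycle_mul, inv_mul_cancel, h.cocycle_one]
    exact eq_neg_of_add_eq_zero_right hinv ▸ W.neg_mem (W.smul_mem _ hx)

theorem moduleFinite [Group.FG C] (h : HasFinitelyManyAffineOrbits φ δ) : Module.Finite R N := by
  obtain ⟨S, hS, hx⟩ := h.exists_finite
  obtain ⟨X, hX, hXfin⟩ := Group.fg_iff.1 ‹Group.FG C›
  set W : Submodule R N := Submodule.span R (S ∪ δ '' X)
  have hδW : ∀ c, δ c ∈ W := h.cocycle_mem_of_closure_eq_top hX fun x hx =>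
    Submodule.subset_span (.inr (Set.mem_image_of_mem δ hx))
  have hW : W = ⊤ := by
    refine eq_top_iff.2 fun x _ => ?_
    obtain ⟨s, hs, c, rfl⟩ := hx x
    exact W.add_mem (W.smul_mem _ (Submodule.subset_span (.inl hs))) (hδW c)
  exact Module.finite_def.2 (Submodule.fg_def.2 ⟨_, hS.union (hXfin.image δ), hW⟩)

end Group

theorem sub_one_smul_comm {C R N : Type*} [CommMonoid C] [Ring R] [AddCommGroup N] [Module R N]
    {φ : C →* R} {δ : C → N} (h : HasFinitelyManyAffineOrbits φ δ) (c d : C) :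
    (φ c - 1) • δ d = (φ d - 1) • δ c := by
  have hcd : φ c • δ d + δ c = φ d • δ c + δ d := by rw [← h.cocycle_mul, ← h.cocycle_mul, mul_comm]
  rw [sub_smul, sub_smul, one_smul, one_smul, sub_eq_sub_iff_add_eq_add, hcd]

theorem sub_one_smul_affine_add {C R N : Type*} [CommMonoid C] [CommRing R] [AddCommGroup N]
    [Module R N] {φ : C →* R} {δ : C → N} (h : HasFinitelyManyAffineOrbits φ δ) (c d : C) (x : N) :
    (φ c - 1) • (φ d • x + δ d) + δ c = φ d • ((φ c - 1) • x + δ c) := by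
  rw [smul_add, h.sub_one_smul_comm c d, sub_smul _ _ (δ c), one_smul, smul_comm, smul_add,
    add_assoc, sub_add_cancel]

end HasFinitelyManyAffineOrbits

theorem exists_smul_add_ne_zero_mem_smul_top {R N : Type*} [CommRing R] [IsDomain R]
    [AddCommGroup N] [Module R N] [Module.IsTorsionFree R N] [Nontrivial N] {j : R} (hj : j ≠ 0)
    {I : Ideal R} (hI : I ≠ ⊥) (hjI : IsCoprime (Ideal.span {j}) I) (u : N) :
    ∃ x : N, j • x + u ≠ 0 ∧ j • x + u ∈ (I • ⊤ : Submodule R N) := by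
  obtain ⟨a, ha, b, hb, hab⟩ := Ideal.isCoprime_iff_exists.1 hjI
  obtain ⟨r, rfl⟩ := Ideal.mem_span_singleton'.1 ha
  have hbu : j • -(r • u) + u = b • u := by
    rw [smul_neg, smul_smul, mul_comm j, neg_add_eq_iff_eq_add, ← add_smul, hab, one_smul]
  have hbmem : b • u ∈ (I • ⊤ : Submodule R N) := Submodule.smul_mem_smul hb trivial
  by_cases hbu0 : b • u = 0
  · obtain ⟨s, hs, hs0⟩ := Submodule.exists_mem_ne_zero_of_ne_bot hI
    obtain ⟨z, hz⟩ := exists_ne (0 : N)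
    have hx : j • (-(r • u) + s • z) + u = j • s • z := by
      rw [smul_add, add_right_comm, hbu, hbu0, zero_add]
    exact ⟨_, hx ▸ smul_ne_zero hj (smul_ne_zero hs0 hz),
      hx ▸ Submodule.smul_mem _ j (Submodule.smul_mem_smul hs trivial)⟩
  · exact ⟨_, hbu ▸ hbu0, hbu ▸ hbmem⟩

theorem exists_forall_mem_pow_smul_top_eq_zero {R N : Type*} [CommRing R] [IsDomain R]
    [IsNoetherianRing R] [AddCommGroup N] [Module R N] [Module.Finite R N]
    [Module.IsTorsionFree R N] {I : Ideal R} (hI : I ≠ ⊤) {F : Set N} (hF : F.Finite) :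
    ∃ n : ℕ, ∀ y ∈ F, y ∈ (I ^ n • ⊤ : Submodule R N) → y = 0 := by
  have hsep : ∀ y ∈ F, ∀ᶠ n in Filter.atTop, y ∈ (I ^ n • ⊤ : Submodule R N) → y = 0 := by
    intro y _
    rcases eq_or_ne y 0 with rfl | hy
    · exact .of_forall fun _ _ => rfl
    have hbot : y ∉ (⨅ n : ℕ, I ^ n • ⊤ : Submodule R N) := by
      rwa [Ideal.iInf_pow_smul_eq_bot_of_isTorsionFree I hI]
    obtain ⟨n, hn⟩ := not_forall.1 (mt (Submodule.mem_iInf _).2 hbot)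
    filter_upwards [Filter.eventually_ge_atTop n] with m hm hym
    exact absurd (Submodule.smul_mono_left (Ideal.pow_le_pow_right hm) hym) hn
  exact ((Filter.eventually_all_finite hF).2 hsep).exists

theorem HasFinitelyManyAffineOrbits.not_isCoprime_span_sub_one {C R N : Type*} [CommGroup C]
    [CommRing R] [IsDomain R] [IsNoetherianRing R] [AddCommGroup N] [Module R N]
    [Module.Finite R N] [Module.IsTorsionFree R N] [Nontrivial N] {φ : C →* R} {δ : C → N}
    (h : HasFinitelyManyAffineOrbits φ δ) {c : C} (hc : φ c - 1 ≠ 0) {I : Ideal R}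
    (hbot : I ≠ ⊥) (htop : I ≠ ⊤) : ¬ IsCoprime (Ideal.span {φ c - 1}) I := by
  intro hcop
  obtain ⟨S, hS, hx⟩ := h.exists_finite
  let f : N → N := fun x => (φ c - 1) • x + δ c
  have hf : ∀ x, ∃ s ∈ S, ∃ d, f x = φ d • f s := fun x => by
    obtain ⟨s, hs, d, rfl⟩ := hx x
    exact ⟨s, hs, d, h.sub_one_smul_affine_add c d s⟩
  obtain ⟨n, hn⟩ := exists_forall_mem_pow_smul_top_eq_zero htop (hS.image f)
  obtain ⟨x, hx0, hxmem⟩ := exists_smul_add_ne_zero_mem_smul_top hc (pow_ne_zero n hbot)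
    (hcop.pow_right (n := n)) (δ c)
  obtain ⟨s, hs, d, hxs⟩ := hf x
  have hfs : f s = φ d⁻¹ • f x := by
    rw [hxs, smul_smul, ← map_mul, inv_mul_cancel, map_one, one_smul]
  have hfs0 : f s = 0 := hn _ (Set.mem_image_of_mem f hs) (hfs ▸ Submodule.smul_mem _ _ hxmem)
  exact hx0 (hxs.trans (by rw [hfs0, smul_zero]))

theorem exists_isMaximal_notMem {R : Type*} [CommRing R] [IsReduced R] [IsJacobsonRing R] {r : R}
    (hr : r ≠ 0) : ∃ m : Ideal R, m.IsMaximal ∧ r ∉ m := by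
  by_contra! hmem
  have hjac : (⊥ : Ideal R).jacobson = ⊥ := IsJacobsonRing.out' _ Ideal.isRadical_bot
  have hr' : r ∈ (⊥ : Ideal R).jacobson := Ideal.mem_sInf.2 fun {m} hm => hmem m hm.2
  exact hr (Ideal.mem_bot.1 (hjac ▸ hr'))

theorem eq_zero_or_injective_of_forall_finite_quotient {k R N : Type*} [CommRing k] [Ring R]
    [Algebra k R] [AddCommGroup N] [Module R N] [Module k N] [IsScalarTower k R N]
    (hN : ¬ Module.Finite k N)
    (hquot : ∀ K : Submodule R N, K ≠ ⊥ → Module.Finite k (N ⧸ K)) (f : N →ₗ[R] N) :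
    f = 0 ∨ Function.Injective f := by
  by_contra! hf
  have hker := hquot f.ker (mt LinearMap.ker_eq_bot.1 hf.2)
  have hcoker : Module.Finite k (N ⧸ f.range.restrictScalars k) :=
    hquot f.range (mt LinearMap.range_eq_bot.1 hf.1)
  have hrange : Module.Finite k (f.range.restrictScalars k) :=
    Module.Finite.equiv (f.quotKerEquivRange.restrictScalars k)
  exact hN (Module.Finite.of_submodule_quotient (f.range.restrictScalars k))

theorem isPrime_annihilator_of_eq_zero_of_smul_eq_zero {R N : Type*} [CommRing R] [AddCommGroup N]
    [Module R N] [Nontrivial N]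
    (h : ∀ r ∉ Module.annihilator R N, ∀ x : N, r • x = 0 → x = 0) :
    (Module.annihilator R N).IsPrime := by
  obtain ⟨z, hz⟩ := exists_ne (0 : N)
  refine ⟨fun htop => hz ?_, fun {a b} hab => ?_⟩
  · simpa using Module.mem_annihilator.1 (htop ▸ Submodule.mem_top : (1 : R) ∈ _) z
  · by_contra! hcon
    refine hz (h b hcon.2 z (h a hcon.1 _ ?_))
    rw [smul_smul]
    exact Module.mem_annihilator.1 hab z

namespace HasFinitelyManyAffineOrbits

variable (k : Type*) {C R N : Type*} [CommGroup C] [Group.FG C] [CommRing k] [IsNoetherianRing k]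
  [IsJacobsonRing k] [CommRing R] [Algebra k R] [Algebra.FiniteType k R] [AddCommGroup N]
  [Module R N] [Module k N] [IsScalarTower k R N] {φ : C →* R} {δ : C → N}

theorem moduleFinite_of_isTorsionFree [IsDomain R] [Module.IsTorsionFree R N]
    (h : HasFinitelyManyAffineOrbits φ δ) : Module.Finite k N := by
  have hN : Module.Finite R N := h.moduleFinite
  have hnoeth : IsNoetherianRing R := Algebra.FiniteType.isNoetherianRing k R
  have hjac : IsJacobsonRing R := isJacobsonRing_of_finiteType (A := k)
  cases subsingleton_or_nontrivial N
  · infer_instance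
  by_cases hφ : ∀ c, φ c = 1
  · have h' : HasFinitelyManyAffineOrbits (1 : C →* k) δ := h.of_smul_eq fun c x => by simp [hφ]
    exact h'.moduleFinite
  obtain ⟨c, hc⟩ := not_forall.1 hφ
  obtain ⟨m, hm, hcm⟩ := exists_isMaximal_notMem (sub_ne_zero.2 hc)
  rcases eq_or_ne m ⊥ with rfl | hbot
  · have hfield : IsField R := Ring.isField_iff_maximal_bot.2 hm
    let _ : Field R := hfield.toField
    have hkR : Module.Finite k R := finite_of_finite_type_of_isJacobsonRing k R
    exact Module.Finite.trans R N
  · refine absurd ?_ (h.not_isCoprime_span_sub_one (sub_ne_zero.2 hc) hbot hm.ne_top)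
    rw [Ideal.isCoprime_iff_sup_eq, sup_comm]
    exact hm.1.2 _ (left_lt_sup.2 (mt (Ideal.span_singleton_le_iff_mem m).1 hcm))

theorem moduleFinite_of_forall_quotient (h : HasFinitelyManyAffineOrbits φ δ)
    (hquot : ∀ K : Submodule R N, K ≠ ⊥ → Module.Finite k (N ⧸ K)) : Module.Finite k N := by
  by_contra hN
  have hnt : Nontrivial N := not_subsingleton_iff_nontrivial.1 fun _ => hN inferInstance
  have hinj : ∀ r ∉ Module.annihilator R N, ∀ x : N, r • x = 0 → x = 0 := by
    intro r hr x hx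
    rcases eq_zero_or_injective_of_forall_finite_quotient hN hquot (LinearMap.lsmul R N r) with
      hzero | hinj
    · exact absurd (Module.mem_annihilator.2 (LinearMap.congr_fun hzero)) hr
    · exact (injective_iff_map_eq_zero _).1 hinj x hx
  have hprime := isPrime_annihilator_of_eq_zero_of_smul_eq_zero hinj
  let _ : Module (R ⧸ Module.annihilator R N) N := Module.quotientAnnihilator
  have htower : IsScalarTower k (R ⧸ Module.annihilator R N) N :=
    Module.IsTorsionBySet.isScalarTower (Module.isTorsionBySet_annihilator R N)
  have htf : Module.IsTorsionFree (R ⧸ Module.annihilator R N) N := by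
    refine .of_smul_eq_zero fun r x hx => ?_
    obtain ⟨r, rfl⟩ := Ideal.Quotient.mk_surjective r
    exact or_iff_not_imp_left.2 fun hr => hinj r (mt Ideal.Quotient.eq_zero_iff_mem.2 hr) x hx
  let π : R →+* R ⧸ Module.annihilator R N := Ideal.Quotient.mk _
  have h' : HasFinitelyManyAffineOrbits (π.toMonoidHom.comp φ) δ := h.of_smul_eq fun _ _ => rfl
  exact hN (h'.moduleFinite_of_isTorsionFree k)

theorem moduleFinite_of_finiteType (h : HasFinitelyManyAffineOrbits φ δ) :
    Module.Finite k N := by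
  have hNR : Module.Finite R N := h.moduleFinite
  have hnoeth : IsNoetherianRing R := Algebra.FiniteType.isNoetherianRing k R
  suffices hquot : ∀ K : Submodule R N, Module.Finite k (N ⧸ K) by
    have hbot := hquot ⊥
    let e := Submodule.quotEquivOfEqBot (⊥ : Submodule R N) rfl
    exact Module.Finite.equiv (e.restrictScalars k)
  intro K
  induction K using IsNoetherian.induction with
  | hgt K ih =>
    refine (h.map K.mkQ_surjective).moduleFinite_of_forall_quotient k fun J hJ => ?_
    have hlt : K < J.comap K.mkQ := by
      refine lt_of_le_of_ne (K.le_comap_mkQ J) fun he => hJ ?_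
      rw [← Submodule.map_comap_eq_of_surjective K.mkQ_surjective J, ← he, Submodule.mkQ_map_self]
    have hfin := ih _ hlt
    have e := Submodule.quotientQuotientEquivQuotient K (J.comap K.mkQ) hlt.le
    rw [Submodule.map_comap_eq_of_surjective K.mkQ_surjective] at e
    exact Module.Finite.equiv (e.symm.restrictScalars k)

end HasFinitelyManyAffineOrbits

theorem isJacobsonRing_int : IsJacobsonRing ℤ := by
  refine isJacobsonRing_iff_prime_eq.2 fun P hP => ?_
  rcases eq_or_ne P ⊥ with rfl | hbot
  · refine (Submodule.eq_bot_iff _).2 fun x hx => mul_self_eq_zero.1 ?_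
    have hunit := Int.isUnit_iff.1 (Ideal.mem_jacobson_bot.1 hx x)
    have hnonneg := mul_self_nonneg x
    omega
  · have hmax := hP.isMaximal hbot
    exact Ideal.jacobson_eq_self_of_isMaximal

theorem group_fg_of_isMulCocycle₁ {C M : Type*} [CommGroup C] [Group.FG C] [CommGroup M]
    [MulDistribMulAction C M] {δ : C → M} (hδ : groupCohomology.IsMulCocycle₁ δ) {S : Set M}
    (hS : S.Finite) (horb : ∀ x, ∃ s ∈ S, ∃ c : C, x = c • s * δ c) : Group.FG M := by
  let ρ := Representation.ofMulDistribMulAction C M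
  let e : M → ρ.asModule := fun x => ρ.asModuleEquiv.symm (Additive.ofMul x)
  have he : ∀ (c : C) (x y : M), e (c • x * y) = MonoidAlgebra.of ℤ C c • e x + e y :=
    fun c x y => by
      rw [← Representation.asModuleEquiv_symm_map_rho, ← map_add]
      rfl
  have haff : HasFinitelyManyAffineOrbits (MonoidAlgebra.of ℤ C) (e ∘ δ) := by
    refine ⟨fun c d => by simp only [Function.comp_apply, hδ c d, he], e '' S, hS.image e, ?_⟩
    intro x
    obtain ⟨s, hs, c, hc⟩ := horb (ρ.asModuleEquiv x).toMul
    refine ⟨e s, Set.mem_image_of_mem e hs, c, ?_⟩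
    rw [Function.comp_apply, ← he, ← hc]
    rfl
  have hC : Monoid.FG C := Group.fg_iff_monoid_fg.1 inferInstance
  have hft : Algebra.FiniteType ℤ (MonoidAlgebra ℤ C) := MonoidAlgebra.finiteType_of_fg
  have hjac := isJacobsonRing_int
  have hfin : Module.Finite ℤ ρ.asModule := haff.moduleFinite_of_finiteType ℤ
  have : Module.Finite ℤ (Additive M) :=
    Module.Finite.equiv ρ.asModuleEquiv.toAddEquiv.toIntLinearEquiv
  exact GroupFG.iff_add_fg.2 (Module.Finite.iff_addGroup_fg.1 this)

theorem group_fg_subgroup_of_commGroup {G : Type*} [CommGroup G] [Group.FG G] (H : Subgroup G) :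
    Group.FG H := by
  have hfin : Module.Finite ℤ (Additive G) :=
    Module.Finite.iff_addGroup_fg.2 (GroupFG.iff_add_fg.1 inferInstance)
  rw [Group.fg_iff_subgroup_fg, Subgroup.fg_iff_add_fg]
  exact Submodule.fg_iff_addSubgroup_fg _ |>.1
    (IsNoetherian.noetherian (AddSubgroup.toIntSubmodule H.toAddSubgroup))

section DoubleCosets

open scoped Pointwise

variable {G : Type*} [Group G] {A B : Subgroup G}

theorem finite_doubleCosetQuotient_iff :
    Finite (DoubleCoset.Quotient (A : Set G) (B : Set G)) ↔
      ∃ T : Set G, T.Finite ∧ (A : Set G) * T * (B : Set G) = Set.univ := by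
  constructor
  · intro h
    let out : DoubleCoset.Quotient (A : Set G) (B : Set G) → G := Quotient.out
    refine ⟨Set.range out, Set.finite_range out, Set.eq_univ_of_forall fun g => ?_⟩
    obtain ⟨a, ha, b, hb, hg⟩ := (DoubleCoset.eq A B _ g).1 (DoubleCoset.out_eq' A B _)
    exact ⟨_, ⟨a, ha, _, Set.mem_range_self (DoubleCoset.mk A B g), rfl⟩, b, hb, hg.symm⟩
  · rintro ⟨T, hT, huniv⟩
    refine Set.finite_univ_iff.1 ((hT.image (DoubleCoset.mk A B)).subset fun q _ => ?_)
    have hq : q.out ∈ (A : Set G) * T * (B : Set G) := huniv ▸ Set.mem_univ _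
    obtain ⟨_, ⟨a, ha, t, ht, rfl⟩, b, hb, hg⟩ := hq
    refine ⟨t, ht, ?_⟩
    rw [← DoubleCoset.out_eq' A B q]
    exact (DoubleCoset.eq A B _ _).2 ⟨a, ha, b, hb, hg.symm⟩

theorem finite_doubleCosetQuotient_map {G' : Type*} [Group G'] {f : G →* G'}
    (hf : Function.Surjective f) (h : Finite (DoubleCoset.Quotient (A : Set G) (B : Set G))) :
    Finite (DoubleCoset.Quotient (A.map f : Set G') (B.map f : Set G')) := by
  rw [finite_doubleCosetQuotient_iff] at h ⊢
  obtain ⟨T, hT, huniv⟩ := h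
  refine ⟨f '' T, hT.image f, ?_⟩
  rw [Subgroup.coe_map, Subgroup.coe_map, ← Set.image_mul, ← Set.image_mul, huniv,
    Set.image_univ_of_surjective hf]

theorem finite_doubleCosetQuotient_subgroupOf {H : Subgroup G} (hA : A ≤ H) (hB : B ≤ H)
    (h : Finite (DoubleCoset.Quotient (A : Set G) (B : Set G))) :
    Finite (DoubleCoset.Quotient (A.subgroupOf H : Set H) (B.subgroupOf H : Set H)) := by
  refine Finite.of_injective (fun q => DoubleCoset.mk A B (q.out : G)) fun p q hpq => ?_
  obtain ⟨a, ha, b, hb, hab⟩ := (DoubleCoset.eq A B _ _).1 hpq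
  rw [← DoubleCoset.out_eq' _ _ p, ← DoubleCoset.out_eq' _ _ q]
  exact (DoubleCoset.eq _ _ _ _).2 ⟨⟨a, hA ha⟩, ha, ⟨b, hB hb⟩, hb, Subtype.ext hab⟩

theorem exists_finite_subset_mul_of_relIndex_ne_zero {A' : Subgroup G} (h : A'.relIndex A ≠ 0) :
    ∃ R : Set G, R.Finite ∧ (A : Set G) ⊆ A' * R := by
  have hfin : (A'.subgroupOf A).FiniteIndex := ⟨h⟩
  obtain ⟨S, hS, -⟩ := (A'.subgroupOf A).exists_isComplement_right 1
  refine ⟨(↑) '' S, hS.finite_right.image _, fun a ha => ?_⟩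
  obtain ⟨a', ha', s, hs, hmul⟩ := hS.mul_eq ▸ Set.mem_univ (⟨a, ha⟩ : A)
  exact ⟨a', ha', s, Set.mem_image_of_mem _ hs, congrArg Subtype.val hmul⟩

theorem finite_doubleCosetQuotient_of_relIndex_ne_zero {A' B' : Subgroup G}
    (hA : A'.relIndex A ≠ 0) (hB : B'.relIndex B ≠ 0)
    (h : Finite (DoubleCoset.Quotient (A : Set G) (B : Set G))) :
    Finite (DoubleCoset.Quotient (A' : Set G) (B' : Set G)) := by
  rw [finite_doubleCosetQuotient_iff] at h ⊢
  obtain ⟨T, hT, huniv⟩ := h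
  obtain ⟨R, hR, hRA⟩ := exists_finite_subset_mul_of_relIndex_ne_zero hA
  obtain ⟨S, hS, hSB⟩ := exists_finite_subset_mul_of_relIndex_ne_zero hB
  have hSB' : (B : Set G) ⊆ S⁻¹ * B' := by
    rw [← inv_coe_set (H := B), ← inv_coe_set (H := B'), ← mul_inv_rev]
    exact Set.inv_subset_inv.2 hSB
  refine ⟨R * T * S⁻¹, (hR.mul hT).mul hS.inv, Set.univ_subset_iff.1 ?_⟩
  calc Set.univ = (A : Set G) * T * (B : Set G) := huniv.symm
    _ ⊆ (A' : Set G) * R * T * (S⁻¹ * (B' : Set G)) := by gcongr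
    _ = (A' : Set G) * (R * T * S⁻¹) * (B' : Set G) := by simp only [mul_assoc]

end DoubleCosets

/-- The subgroup of pairs `(a, b)` with `a M = b M`, that is, of those for which the map
`x ↦ a * x * b⁻¹` carries `M` to itself. -/
def compatiblePairs {G : Type*} [Group G] (A B M : Subgroup G) [M.Normal] : Subgroup (A × B) :=
  ((QuotientGroup.mk' M).comp (A.subtype.comp (MonoidHom.fst A B))).eqLocus
    ((QuotientGroup.mk' M).comp (B.subtype.comp (MonoidHom.snd A B)))

namespace compatiblePairs

variable {G : Type*} [Group G] {A B M : Subgroup G} [M.Normal]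

theorem mem_iff {p : A × B} : p ∈ compatiblePairs A B M ↔ (p.1 * (p.2 : G)⁻¹ : G) ∈ M := by
  rw [← QuotientGroup.eq_one_iff (N := M), QuotientGroup.mk_mul, QuotientGroup.mk_inv,
    mul_inv_eq_one]
  rfl

instance : MulDistribMulAction (compatiblePairs A B M) M :=
  .compHom M ((MulAut.conjNormal (H := M)).comp
    (A.subtype.comp ((MonoidHom.fst A B).comp (compatiblePairs A B M).subtype)))

/-- The crossed homomorphism `(a, b) ↦ a * b⁻¹` from compatible pairs to `M`. -/
def offset (c : compatiblePairs A B M) : M :=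
  ⟨c.1.1 * (c.1.2 : G)⁻¹, mem_iff.1 c.2⟩

theorem coe_smul (c : compatiblePairs A B M) (x : M) :
    ((c • x : M) : G) = c.1.1 * x * (c.1.1 : G)⁻¹ := rfl

theorem coe_offset (c : compatiblePairs A B M) : (offset c : G) = c.1.1 * (c.1.2 : G)⁻¹ := rfl

open scoped IsMulCommutative in
theorem isMulCocycle₁_offset [IsMulCommutative M] :
    groupCohomology.IsMulCocycle₁ (offset : compatiblePairs A B M → M) := fun c d =>
  Subtype.ext (by simp [coe_smul, coe_offset, mul_assoc])

theorem exists_eq_smul_mul_offset {x y : M}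
    (h : DoubleCoset.mk A B (x : G) = DoubleCoset.mk A B y) :
    ∃ c : compatiblePairs A B M, y = c • x * offset c := by
  obtain ⟨a, ha, b, hb, hy⟩ := (DoubleCoset.eq A B _ _).1 h
  have hy' : (y : G) = a * x * a⁻¹ * (a * b) := by rw [hy]; group
  have hc : ((⟨a, ha⟩, ⟨b⁻¹, B.inv_mem hb⟩) : A × B) ∈ compatiblePairs A B M := by
    have hconj : a * x * a⁻¹ ∈ M := ‹M.Normal›.conj_mem _ x.2 a
    rw [mem_iff, inv_inv, ← M.mul_mem_cancel_left hconj, ← hy']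
    exact y.2
  exact ⟨⟨_, hc⟩, Subtype.ext (by simp [coe_smul, coe_offset, hy'])⟩

end compatiblePairs

open scoped IsMulCommutative in
theorem group_fg_of_finite_doubleCosetQuotient {G : Type*} [Group G] {A B : Subgroup G}
    [IsMulCommutative A] [IsMulCommutative B] (hA : Group.FG A) (hB : Group.FG B)
    (h : Finite (DoubleCoset.Quotient (A : Set G) (B : Set G))) (M : Subgroup G) [M.Normal]
    [IsMulCommutative M] : Group.FG M := by
  have hfg : Group.FG (compatiblePairs A B M) := group_fg_subgroup_of_commGroup _
  let toDoubleCoset : M → DoubleCoset.Quotient (A : Set G) B := fun x => DoubleCoset.mk A B x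
  choose rep hrep using fun q : Set.range toDoubleCoset => q.2
  refine group_fg_of_isMulCocycle₁ (compatiblePairs.isMulCocycle₁_offset (A := A) (B := B))
    (Set.finite_range rep) fun x => ?_
  exact ⟨_, Set.mem_range_self ⟨toDoubleCoset x, x, rfl⟩,
    compatiblePairs.exists_eq_smul_mul_offset (hrep _)⟩

/-- One step of a polycyclic series: `K` is a normal subgroup of `L` with cyclic quotient. -/
def IsCyclicStep {G : Type*} [Group G] (K L : Subgroup G) : Prop :=
  K ≤ L ∧ ∃ _ : (K.subgroupOf L).Normal, IsCyclic (L ⧸ K.subgroupOf L)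

theorem isCyclic_quotient_iff {G : Type*} [Group G] {N : Subgroup G} [N.Normal] :
    IsCyclic (G ⧸ N) ↔ ∃ x, N ⊔ Subgroup.zpowers x = ⊤ := by
  rw [isCyclic_iff_exists_zpowers_eq_top, (QuotientGroup.mk'_surjective N).exists]
  refine exists_congr fun x => ?_
  rw [← MonoidHom.map_zpowers, ← QuotientGroup.comap_map_mk',
    ← Subgroup.comap_top (QuotientGroup.mk' N),
    (Subgroup.comap_injective (QuotientGroup.mk'_surjective N)).eq_iff]

theorem isCyclicStep_iff {G : Type*} [Group G] {K L : Subgroup G} :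
    IsCyclicStep K L ↔ ∃ x ∈ Subgroup.normalizer (K : Set G), K ⊔ Subgroup.zpowers x = L := by
  constructor
  · rintro ⟨hKL, hnormal, hcyclic⟩
    obtain ⟨x, hx⟩ := isCyclic_quotient_iff.1 hcyclic
    refine ⟨x, (Subgroup.normal_subgroupOf_iff_le_normalizer hKL).1 hnormal x.2, ?_⟩
    have := congrArg (Subgroup.map L.subtype) hx
    rwa [Subgroup.map_sup, Subgroup.map_subgroupOf_eq_of_le hKL, MonoidHom.map_zpowers,
      ← MonoidHom.range_eq_map, Subgroup.range_subtype] at this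
  · rintro ⟨x, hx, rfl⟩
    have hKL : K ≤ K ⊔ Subgroup.zpowers x := le_sup_left
    have hxL : x ∈ K ⊔ Subgroup.zpowers x := Subgroup.mem_sup_right (Subgroup.mem_zpowers x)
    have hnormal : (K.subgroupOf (K ⊔ Subgroup.zpowers x)).Normal :=
      (Subgroup.normal_subgroupOf_iff_le_normalizer hKL).2
        (sup_le Subgroup.le_normalizer (Subgroup.zpowers_le.2 hx))
    refine ⟨hKL, hnormal, isCyclic_quotient_iff.2 ⟨⟨x, hxL⟩, ?_⟩⟩
    refine Subgroup.map_injective (Subgroup.subtype_injective _) ?_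
    rw [Subgroup.map_sup, Subgroup.map_subgroupOf_eq_of_le hKL, MonoidHom.map_zpowers,
      ← MonoidHom.range_eq_map, Subgroup.range_subtype]
    rfl

theorem IsCyclicStep.comap {G G' : Type*} [Group G] [Group G'] {f : G →* G'}
    (hf : Function.Surjective f) {K L : Subgroup G'} (h : IsCyclicStep K L) :
    IsCyclicStep (K.comap f) (L.comap f) := by
  rw [isCyclicStep_iff] at h ⊢
  obtain ⟨x, hx, rfl⟩ := h
  obtain ⟨x, rfl⟩ := hf x
  refine ⟨x, ?_, ?_⟩
  · rw [← Subgroup.comap_normalizer_eq_of_surjective _ hf]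
    exact hx
  · rw [← Subgroup.comap_sup_eq f K _ hf, ← MonoidHom.map_zpowers, Subgroup.comap_map_eq,
      sup_left_comm, sup_eq_left.2 (Subgroup.ker_le_comap f K), sup_comm]

theorem isPolycyclic_iff_reflTransGen {G : Type*} [Group G] :
    IsPolycyclic G ↔ Relation.ReflTransGen IsCyclicStep (⊥ : Subgroup G) ⊤ := by
  constructor
  · rintro ⟨n, H, h0, hn, hH⟩
    rw [← h0, ← hn]
    exact (reflTransGen_of_succ_of_le (Function.onFun IsCyclicStep H)
      (fun i hi => hH i hi.2) n.zero_le).lift H fun _ _ hstep => hstep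
  · suffices hseries : ∀ L : Subgroup G, Relation.ReflTransGen IsCyclicStep ⊥ L →
        ∃ (n : ℕ) (H : ℕ → Subgroup G), H 0 = ⊥ ∧ H n = L ∧
          ∀ i < n, IsCyclicStep (H i) (H (i + 1)) from hseries ⊤
    intro L hL
    induction hL with
    | refl => exact ⟨0, fun _ => ⊥, rfl, rfl, fun i hi => absurd hi i.not_lt_zero⟩
    | @tail K L _ hKL ih =>
      obtain ⟨n, H, h0, hn, hH⟩ := ih
      refine ⟨n + 1, fun i => if i ≤ n then H i else L, by simp [h0], by simp, fun i hi => ?_⟩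
      rcases Nat.lt_succ_iff_lt_or_eq.1 hi with hi | rfl
      · simpa [hi.le, Nat.succ_le_of_lt hi] using hH i hi
      · simpa [hn] using hKL

theorem isCyclicStep_closure_insert {G : Type*} [Group G] {x : G} {s : Set G}
    (h : ∀ y ∈ s, x * y = y * x) :
    IsCyclicStep (Subgroup.closure s) (Subgroup.closure (insert x s)) := by
  have hx : x ∈ Subgroup.centralizer (Subgroup.closure s : Set G) := by
    rw [Subgroup.centralizer_closure]
    exact Subgroup.mem_centralizer_iff.2 fun y hy => (h y hy).symm
  refine isCyclicStep_iff.2 ⟨x, Subgroup.centralizer_le_normalizer _ hx, ?_⟩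
  rw [Set.insert_eq, Subgroup.closure_union, ← Subgroup.zpowers_eq_closure, sup_comm]

theorem reflTransGen_isCyclicStep_of_fg {G : Type*} [Group G] {M : Subgroup G}
    [IsMulCommutative M] (hM : M.FG) : Relation.ReflTransGen IsCyclicStep ⊥ M := by
  obtain ⟨S, hS, hfin⟩ := (Subgroup.fg_iff M).1 hM
  have hcomm : ∀ x ∈ S, ∀ y ∈ S, x * y = y * x := fun x hx y hy =>
    setLike_mul_comm (s := M) (hS ▸ Subgroup.subset_closure hx) (hS ▸ Subgroup.subset_closure hy)
  rw [← hS]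
  refine Set.Finite.induction_on_subset S hfin ?_ fun hx hs _ ih => ?_
  · rw [Subgroup.closure_empty]
  · exact ih.tail (isCyclicStep_closure_insert fun y hy => hcomm _ hx y (hs hy))

theorem isPolycyclic_of_quotient {G : Type*} [Group G] (M : Subgroup G) [M.Normal]
    [IsMulCommutative M] (hM : M.FG) (h : IsPolycyclic (G ⧸ M)) : IsPolycyclic G := by
  rw [isPolycyclic_iff_reflTransGen] at h ⊢
  have hlift := Relation.ReflTransGen.lift (Subgroup.comap (QuotientGroup.mk' M))
    (fun _ _ hKL => hKL.comap (QuotientGroup.mk'_surjective M)) _ _ h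
  rw [Function.onFun, MonoidHom.comap_bot, QuotientGroup.ker_mk', Subgroup.comap_top] at hlift
  exact (reflTransGen_isCyclicStep_of_fg hM).trans hlift

theorem isPolycyclic_of_finite_doubleCosetQuotient {G : Type*} [Group G] {A B : Subgroup G}
    [IsMulCommutative A] [IsMulCommutative B] (hA : Group.FG A) (hB : Group.FG B)
    (h : Finite (DoubleCoset.Quotient (A : Set G) (B : Set G))) {n : ℕ}
    (hn : derivedSeries G n = ⊥) : IsPolycyclic G := by
  induction n generalizing G with
  | zero => exact ⟨0, fun _ => ⊥, rfl, hn.symm, fun i hi => absurd hi i.not_lt_zero⟩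
  | succ n ih =>
    let M := derivedSeries G n
    have hM : IsMulCommutative M := Subgroup.commutator_self_eq_bot_iff.1 hn
    have hMfg := group_fg_of_finite_doubleCosetQuotient hA hB h M
    refine isPolycyclic_of_quotient M ((Group.fg_iff_subgroup_fg M).1 hMfg) ?_
    let π := QuotientGroup.mk' M
    have hπ : Function.Surjective π := QuotientGroup.mk'_surjective M
    refine ih (Group.fg_of_surjective (π.subgroupMap_surjective A))
      (Group.fg_of_surjective (π.subgroupMap_surjective B))
      (finite_doubleCosetQuotient_map hπ h) ?_
    rw [← map_derivedSeries_eq hπ, QuotientGroup.map_mk'_self]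

theorem group_fg_subgroupOf_iff {G : Type*} [Group G] {K H : Subgroup G} (h : K ≤ H) :
    Group.FG (K.subgroupOf H) ↔ Group.FG K :=
  let e := Subgroup.subgroupOfEquivOfLe h
  ⟨fun _ => Group.fg_of_surjective (f := e.toMonoidHom) e.surjective,
    fun _ => Group.fg_of_surjective (f := e.symm.toMonoidHom) e.symm.surjective⟩

theorem IsVirtuallyAbelian.exists_fg_isMulCommutative_le {G : Type*} [Group G] {A H : Subgroup G}
    (hA : IsVirtuallyAbelian A) (hfg : A.FG) (hH : H.FiniteIndex) :
    ∃ A' ≤ H, A'.relIndex A ≠ 0 ∧ IsMulCommutative A' ∧ Group.FG A' := by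
  obtain ⟨D, hD, hcomm⟩ := hA
  let E := D ⊓ H.subgroupOf A
  have hE : E.FiniteIndex := inferInstance
  have hAfg : Group.FG A := (Group.fg_iff_subgroup_fg A).2 hfg
  have hEfg : Group.FG E := inferInstance
  have hEcomm : IsMulCommutative E := .of_setLike_mul_comm fun a ha b hb =>
    setLike_mul_comm (s := D) ha.1 hb.1
  refine ⟨E.map A.subtype, Subgroup.map_le_iff_le_comap.2 inf_le_right, ?_, inferInstance,
    Group.fg_of_surjective (A.subtype.subgroupMap_surjective E)⟩
  rw [Subgroup.relIndex, Subgroup.subgroupOf,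
    Subgroup.comap_map_eq_self_of_injective A.subtype_injective]
  exact hE.index_ne_zero

theorem theoremC {G : Type*} [Group G] (hG : IsVirtuallySoluble G)
    (A B : Subgroup G) (hAfg : A.FG) (hBfg : B.FG)
    (hA : IsVirtuallyAbelian A) (hB : IsVirtuallyAbelian B)
    (hfin : Finite (DoubleCoset.Quotient (A : Set G) (B : Set G))) :
    IsVirtuallyPolycyclic G := by
  obtain ⟨H, hH, n, hn⟩ := hG
  obtain ⟨A', hA'H, hA'A, hA'comm, hA'fg⟩ := hA.exists_fg_isMulCommutative_le hAfg hH
  obtain ⟨B', hB'H, hB'B, hB'comm, hB'fg⟩ := hB.exists_fg_isMulCommutative_le hBfg hH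
  have hfin' : Finite (DoubleCoset.Quotient (A' : Set G) (B' : Set G)) :=
    finite_doubleCosetQuotient_of_relIndex_ne_zero hA'A hB'B hfin
  exact ⟨H, hH, isPolycyclic_of_finite_doubleCosetQuotient
    ((group_fg_subgroupOf_iff hA'H).2 hA'fg) ((group_fg_subgroupOf_iff hB'H).2 hB'fg)
    (finite_doubleCosetQuotient_subgroupOf hA'H hB'H hfin') hn⟩
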